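/- **Theorem (Forcing for C-F-S graphs).** Let $H$ be a finite simple bipartite graph with sides $A$ and $B$ such that some vertex $x\in A$ is adjacent to every vertex of $B$, and suppose that $H$ contains a cycle (for connected $H$ this says exactly that $H$ is not a tree). Let $(\Omega,\mu)$ be a probability space, let $W:\Omega^2\to[0,\infty)$ be bounded, measurable and symmetric ($W(x,y)=W(y,x)$ for all $x,y\in\Omega$), and put $$d=\int_{\Omega^2}W\,d(\mu\times\mu),\qquad t(H,W)=\int_{\Omega^{V(H)}}\prod_{\{i,j\}\in E(H)}W(x_i,x_j)\,\prod_{i\in V(H)}d\mu(x_i).$$ Then $t(H,W)=d^{|E(H)|}$ if and only if $W$ is constant $(\mu\times\mu)$-almost everywhere on $\Omega^2$. -/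

import Mathlib

open MeasureTheory

/-- The homomorphism density `t(H, W) = 𝔼 ∏_{ij ∈ E(H)} W(x_i, x_j)` of a finite graph `H` in a
symmetric function `W`, where the points `x_i`, `i ∈ V(H)`, are independent and each is
distributed according to `μ`. The product has one factor for each (unordered) edge. -/
noncomputable def homDensity {V Ω : Type*} [Fintype V] [MeasurableSpace Ω]
    (H : SimpleGraph V) [Fintype H.edgeSet] (μ : Measure Ω)
    (W : Ω → Ω → ℝ) (hW : ∀ x y, W x y = W y x) : ℝ :=
  ∫ x : V → Ω, ∏ e ∈ H.edgeFinset, Sym2.lift ⟨W, hW⟩ (e.map x) ∂(Measure.pi fun _ => μ)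

/-- The edge density `d = 𝔼 W = t(P₂, W)`, where `P₂` is the single edge. -/
noncomputable def edgeDensity {Ω : Type*} [MeasurableSpace Ω] (μ : Measure Ω)
    (W : Ω → Ω → ℝ) : ℝ :=
  ∫ p : Ω × Ω, W p.1 p.2 ∂(μ.prod μ)

/-! A constant `W` gives equality by substitution. For the converse, the case `d = 0` is trivial,
and otherwise division by `d` reduces to `d = 1`, `t(H, W) = 1`. No edge joins two vertices outside
`B`, so these can be integrated out: `t` is the integral of the product of the codegrees `g_v` on
`N(v)`, over `v ∉ B`, where `N(x) = B`.

Suppose first that `W` is bounded away from `0`, with degree function `f`. The probability density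
`s = f(z) ∏ W(z, ω_u) / f(z)` on stars with leaf set `B` satisfies `∏ W = s f^(|B|-1)`, so Jensen
under `s` gives `log t ≥ (|B|-1) ∫ f log f + ∑_{v ≠ x} ∫ s log g_v`. A second Jensen, over the
centre with the leaves fixed, bounds each summand with `N(v)` nonempty below by the relative entropy
of the joint density of the leaves in `N(v)`, plus `(|N(v)|-1) ∫ f log f`. All these entropies are
nonnegative; `klFun_add_klFun_le_log_integral` keeps two of them. Perturbing a general `W` and
passing to the limit, `t = 1` forces `f = 1` and `g_{v₀} = 1` almost everywhere
(`ae_wdegree_eq_one_and_codegree_eq_one`).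

The cycle supplies `v₀ ≠ x` with at least two neighbours. Testing `g_{v₀} = 1` against the indicator
of `t` in two coordinates shows that `z ↦ ∫_t W(z, y) dy` has second moment `μ(t)²`; its mean is
`μ(t)`, so it is almost everywhere constant. Hence `W` integrates to `μ(s) μ(t)` on every rectangle,
and `W = 1` almost everywhere. -/

/-- `F` is measurable and bounded. -/
def IsBddMeas {α : Type*} [MeasurableSpace α] (F : α → ℝ) : Prop :=
  Measurable F ∧ ∃ C : ℝ, ∀ x, |F x| ≤ C

/-- `F` is measurable, bounded, and bounded away from `0` by a positive constant. -/
def IsBddPos {α : Type*} [MeasurableSpace α] (F : α → ℝ) : Prop :=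
  Measurable F ∧ ∃ a : ℝ, 0 < a ∧ ∃ b : ℝ, ∀ x, a ≤ F x ∧ F x ≤ b

/-! ### Bounded and positive functions; Jensen's inequality for the logarithm -/

section BoundedFunctions

variable {α β : Type*} [MeasurableSpace α] [MeasurableSpace β]

namespace IsBddMeas

theorem integrable {F : α → ℝ} (hF : IsBddMeas F) (μ : Measure α) [IsFiniteMeasure μ] :
    Integrable F μ := by
  obtain ⟨hm, C, hC⟩ := hF
  exact Integrable.of_bound hm.aestronglyMeasurable C (Filter.Eventually.of_forall hC)

theorem const (c : ℝ) : IsBddMeas (fun _ : α => c) := ⟨measurable_const, |c|, fun _ => le_rfl⟩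

theorem add {F G : α → ℝ} (hF : IsBddMeas F) (hG : IsBddMeas G) :
    IsBddMeas (fun x => F x + G x) := by
  obtain ⟨hm, C, hC⟩ := hF
  obtain ⟨hm', C', hC'⟩ := hG
  exact ⟨hm.add hm', C + C', fun x => (abs_add_le _ _).trans (add_le_add (hC x) (hC' x))⟩

theorem mul {F G : α → ℝ} (hF : IsBddMeas F) (hG : IsBddMeas G) :
    IsBddMeas (fun x => F x * G x) := by
  obtain ⟨hm, C, hC⟩ := hF
  obtain ⟨hm', C', hC'⟩ := hG
  refine ⟨hm.mul hm', C * C', fun x => ?_⟩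
  rw [abs_mul]
  exact mul_le_mul (hC x) (hC' x) (abs_nonneg _) ((abs_nonneg _).trans (hC x))

theorem prod {ι : Type*} (s : Finset ι) {F : ι → α → ℝ} (hF : ∀ i ∈ s, IsBddMeas (F i)) :
    IsBddMeas (fun x => ∏ i ∈ s, F i x) := by
  classical
  induction s using Finset.induction_on with
  | empty => simpa using const (α := α) 1
  | insert i s hi ih =>
    simp only [Finset.prod_insert hi]
    exact (hF i (by simp)).mul (ih fun j hj => hF j (by simp [hj]))

theorem sum {ι : Type*} (s : Finset ι) {F : ι → α → ℝ} (hF : ∀ i ∈ s, IsBddMeas (F i)) :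
    IsBddMeas (fun x => ∑ i ∈ s, F i x) := by
  classical
  induction s using Finset.induction_on with
  | empty => simpa using const (α := α) 0
  | insert i s hi ih =>
    simp only [Finset.sum_insert hi]
    exact (hF i (by simp)).add (ih fun j hj => hF j (by simp [hj]))

theorem comp {F : β → ℝ} (hF : IsBddMeas F) {g : α → β} (hg : Measurable g) :
    IsBddMeas (fun x => F (g x)) := by
  obtain ⟨hm, C, hC⟩ := hF
  exact ⟨hm.comp hg, C, fun x => hC _⟩

theorem integral_right {F : α → β → ℝ} (hF : IsBddMeas (fun p : α × β => F p.1 p.2))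
    (μ : Measure β) [IsProbabilityMeasure μ] : IsBddMeas (fun x => ∫ y, F x y ∂μ) := by
  obtain ⟨hm, C, hC⟩ := hF
  refine ⟨(hm.stronglyMeasurable.integral_prod_right').measurable, C, fun x => ?_⟩
  have := norm_integral_le_of_norm_le_const (μ := μ) (f := fun y => F x y) (C := C)
    (Filter.Eventually.of_forall fun y => hC (x, y))
  simpa using this

theorem klFun {F : α → ℝ} (hF : IsBddMeas F) :
    IsBddMeas (fun x => InformationTheory.klFun (F x)) := by
  obtain ⟨hm, C, hC⟩ := hF
  obtain ⟨D, hD⟩ := (isCompact_Icc (a := -C) (b := C)).exists_bound_of_continuousOn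
    InformationTheory.continuous_klFun.continuousOn
  exact ⟨InformationTheory.measurable_klFun.comp hm, D, fun x => hD _ (abs_le.mp (hC x))⟩

end IsBddMeas

namespace IsBddPos

theorem pos {F : α → ℝ} (hF : IsBddPos F) (x : α) : 0 < F x := by
  obtain ⟨-, a, ha, b, h⟩ := hF
  exact ha.trans_le (h x).1

theorem isBddMeas {F : α → ℝ} (hF : IsBddPos F) : IsBddMeas F := by
  refine ⟨hF.1, ?_⟩
  obtain ⟨b, h⟩ := hF.2.choose_spec.2
  exact ⟨b, fun x => by rw [abs_of_pos (hF.pos x)]; exact (h x).2⟩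

theorem const {c : ℝ} (hc : 0 < c) : IsBddPos (fun _ : α => c) :=
  ⟨measurable_const, c, hc, c, fun _ => ⟨le_rfl, le_rfl⟩⟩

theorem mul {F G : α → ℝ} (hF : IsBddPos F) (hG : IsBddPos G) :
    IsBddPos (fun x => F x * G x) := by
  have hF0 := hF.pos
  have hG0 := hG.pos
  obtain ⟨hm, a, ha, b, h⟩ := hF
  obtain ⟨hm', a', ha', b', h'⟩ := hG
  exact ⟨hm.mul hm', a * a', mul_pos ha ha', b * b', fun x =>
    ⟨mul_le_mul (h x).1 (h' x).1 ha'.le (hF0 x).le,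
      mul_le_mul (h x).2 (h' x).2 (hG0 x).le ((hF0 x).le.trans (h x).2)⟩⟩

theorem inv {F : α → ℝ} (hF : IsBddPos F) : IsBddPos (fun x => (F x)⁻¹) := by
  have hF0 := hF.pos
  obtain ⟨hm, a, ha, b, h⟩ := hF
  -- If `α` is empty, nothing forces `b` to be positive; `max b 1` always is.
  refine ⟨hm.inv, (max b 1)⁻¹, by positivity, a⁻¹, fun x => ⟨?_, ?_⟩⟩
  · exact inv_anti₀ (hF0 x) ((h x).2.trans (le_max_left _ _))
  · exact inv_anti₀ ha (h x).1

theorem div {F G : α → ℝ} (hF : IsBddPos F) (hG : IsBddPos G) :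
    IsBddPos (fun x => F x / G x) := by
  simpa only [div_eq_mul_inv] using hF.mul hG.inv

theorem prod {ι : Type*} (s : Finset ι) {F : ι → α → ℝ} (hF : ∀ i ∈ s, IsBddPos (F i)) :
    IsBddPos (fun x => ∏ i ∈ s, F i x) := by
  classical
  induction s using Finset.induction_on with
  | empty => simpa using const (α := α) one_pos
  | insert i s hi ih =>
    simp only [Finset.prod_insert hi]
    exact (hF i (by simp)).mul (ih fun j hj => hF j (by simp [hj]))

theorem pow {F : α → ℝ} (hF : IsBddPos F) (n : ℕ) : IsBddPos (fun x => F x ^ n) := by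
  simpa using prod (Finset.range n) (F := fun _ => F) fun _ _ => hF

theorem comp {F : β → ℝ} (hF : IsBddPos F) {g : α → β} (hg : Measurable g) :
    IsBddPos (fun x => F (g x)) := by
  obtain ⟨hm, a, ha, b, h⟩ := hF
  exact ⟨hm.comp hg, a, ha, b, fun x => h _⟩

theorem integral_right {F : α → β → ℝ} (hF : IsBddPos (fun p : α × β => F p.1 p.2))
    (μ : Measure β) [IsProbabilityMeasure μ] : IsBddPos (fun x => ∫ y, F x y ∂μ) := by
  have hi : ∀ x, Integrable (F x) μ := fun x =>
    (hF.isBddMeas.comp (measurable_prodMk_left (x := x))).integrable μ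
  refine ⟨(hF.isBddMeas.integral_right μ).1, ?_⟩
  obtain ⟨hm, a, ha, b, h⟩ := hF
  refine ⟨a, ha, b, fun x => ⟨?_, ?_⟩⟩
  · simpa using integral_mono (integrable_const a) (hi x) fun y => (h (x, y)).1
  · simpa using integral_mono (hi x) (integrable_const b) fun y => (h (x, y)).2

theorem log {F : α → ℝ} (hF : IsBddPos F) : IsBddMeas (fun x => Real.log (F x)) := by
  have hF0 := hF.pos
  obtain ⟨hm, a, ha, b, h⟩ := hF
  refine ⟨Real.measurable_log.comp hm, max |Real.log a| |Real.log b|, fun x => ?_⟩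
  exact abs_le_max_abs_abs (Real.log_le_log ha (h x).1) (Real.log_le_log (hF0 x) (h x).2)

theorem integral_pos {F : α → ℝ} (hF : IsBddPos F) (μ : Measure α) [IsProbabilityMeasure μ] :
    0 < ∫ x, F x ∂μ := by
  have hi := hF.isBddMeas.integrable μ
  obtain ⟨hm, a, ha, b, h⟩ := hF
  have := integral_mono (integrable_const a) hi fun y => (h y).1
  simp at this
  linarith

/-- Jensen's inequality for the logarithm, with an unnormalized weight `q`. -/
theorem integral_mul_log_le {q F : α → ℝ} (hq : IsBddPos q) (hF : IsBddPos F) (μ : Measure α)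
    [IsProbabilityMeasure μ] :
    ∫ x, q x * Real.log (F x) ∂μ ≤
      (∫ x, q x ∂μ) * Real.log ((∫ x, q x * F x ∂μ) / ∫ x, q x ∂μ) := by
  have hQ := hq.integral_pos μ
  have hR := (hq.mul hF).integral_pos μ
  set Q := ∫ x, q x ∂μ
  set R := ∫ x, q x * F x ∂μ with hRdef
  -- The majorant is `q` times the tangent line to `log` at the weighted mean `R / Q`, evaluated at
  -- `F`.
  have hint : Integrable (fun x => (Real.log (R / Q) - 1) * q x + Q / R * (q x * F x)) μ :=
    ((hq.isBddMeas.integrable μ).const_mul _).add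
      (((hq.mul hF).isBddMeas.integrable μ).const_mul _)
  refine (integral_mono ((hq.isBddMeas.mul hF.log).integrable μ) hint fun x => ?_).trans ?_
  · have h1 := Real.log_le_sub_one_of_pos (div_pos (hF.pos x) (div_pos hR hQ))
    rw [Real.log_div (hF.pos x).ne' (div_pos hR hQ).ne'] at h1
    have h2 := mul_le_mul_of_nonneg_left h1 (hq.pos x).le
    have h3 : F x / (R / Q) = Q / R * F x := by field_simp
    rw [h3] at h2
    simp only
    linarith
  · rw [integral_add ((hq.isBddMeas.integrable μ).const_mul _)
      (((hq.mul hF).isBddMeas.integrable μ).const_mul _), integral_const_mul, integral_const_mul,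
      ← hRdef]
    have : Q / R * R = Q := by field_simp
    rw [this]
    apply le_of_eq
    ring

end IsBddPos

end BoundedFunctions

/-! ### Codegree functions -/

section Codegree

open Classical in
theorem prod_update_of_notMem {V Ω : Type*} {F : Ω → ℝ} {S : Finset V} {v : V} (hv : v ∉ S) (ω : V → Ω)
    (z : Ω) : ∏ u ∈ S, F (Function.update ω v z u) = ∏ u ∈ S, F (ω u) :=
  Finset.prod_congr rfl fun u hu => by
    rw [Function.update_of_ne (ne_of_mem_of_not_mem hu hv)]

variable {V Ω : Type*} [MeasurableSpace Ω]

/-- The codegree function of `W` on the coordinates in `S`. -/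
noncomputable def codegree (μ : Measure Ω) (W : Ω → Ω → ℝ) (S : Finset V) (ω : V → Ω) : ℝ :=
  ∫ z, ∏ u ∈ S, W z (ω u) ∂μ

theorem IsBddMeas.codegree {μ : Measure Ω} [IsProbabilityMeasure μ] {W : Ω → Ω → ℝ}
    (hW : IsBddMeas fun p : Ω × Ω => W p.1 p.2) (S : Finset V) :
    IsBddMeas (codegree μ W S) := by
  refine IsBddMeas.integral_right (F := fun (ω : V → Ω) z => ∏ u ∈ S, W z (ω u)) ?_ μ
  exact IsBddMeas.prod S fun u _ => hW.comp (g := fun p : (V → Ω) × Ω => (p.2, p.1 u))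
    (measurable_snd.prodMk ((measurable_pi_apply u).comp measurable_fst))

theorem IsBddPos.codegree {μ : Measure Ω} [IsProbabilityMeasure μ] {W : Ω → Ω → ℝ}
    (hW : IsBddPos fun p : Ω × Ω => W p.1 p.2) (S : Finset V) :
    IsBddPos (codegree μ W S) := by
  refine IsBddPos.integral_right (F := fun (ω : V → Ω) z => ∏ u ∈ S, W z (ω u)) ?_ μ
  exact IsBddPos.prod S fun u _ => hW.comp (g := fun p : (V → Ω) × Ω => (p.2, p.1 u))
    (measurable_snd.prodMk ((measurable_pi_apply u).comp measurable_fst))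

open Classical in
theorem codegree_update_of_notMem (μ : Measure Ω) (W : Ω → Ω → ℝ) {S : Finset V} {v : V}
    (hv : v ∉ S) (ω : V → Ω) (z : Ω) :
    codegree μ W S (Function.update ω v z) = codegree μ W S ω := by
  simp only [codegree, prod_update_of_notMem hv]

end Codegree

/-! ### Integrating out coordinates of a product measure -/

section Update

variable {V Ω : Type*} [Fintype V] [MeasurableSpace Ω]

open Classical in
-- Resampling one coordinate does not change the law of independent points. This gives Fubini in a
-- single coordinate without splitting the index type.
theorem measurePreserving_update (μ : Measure Ω) [IsProbabilityMeasure μ] (v : V) :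
    MeasurePreserving (fun p : Ω × (V → Ω) => Function.update p.2 v p.1)
      (μ.prod (Measure.pi fun _ => μ)) (Measure.pi fun _ => μ) := by
  have hm : Measurable (fun p : Ω × (V → Ω) => Function.update p.2 v p.1) := by
    refine measurable_pi_lambda _ fun u => ?_
    by_cases h : u = v
    · subst h; simpa using measurable_fst
    · simpa [h, Function.comp_def] using
      (measurable_pi_apply (X := fun _ : V => Ω) u).comp (measurable_snd (α := Ω))
  refine ⟨hm, (Measure.pi_eq fun s hs => ?_).symm⟩
  rw [Measure.map_apply hm (MeasurableSet.univ_pi hs)]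
  have : (fun p : Ω × (V → Ω) => Function.update p.2 v p.1) ⁻¹' Set.univ.pi s =
      s v ×ˢ Set.univ.pi (Function.update s v Set.univ) := by
    ext p
    simp only [Set.mem_preimage, Set.mem_pi, Set.mem_univ, true_implies, Set.mem_prod]
    constructor
    · intro h
      refine ⟨by simpa using h v, fun u => ?_⟩
      by_cases hu : u = v
      · subst hu; simp
      · simpa [hu] using h u
    · rintro ⟨h1, h2⟩ u
      by_cases hu : u = v
      · subst hu; simpa using h1
      · simpa [hu] using h2 u
  rw [this, Measure.prod_prod, Measure.pi_pi, ← Finset.mul_prod_erase _ _ (Finset.mem_univ v),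
    ← Finset.mul_prod_erase _ (fun i => μ (s i)) (Finset.mem_univ v)]
  simp only [Function.update_self, measure_univ, one_mul]
  congr 1
  refine Finset.prod_congr rfl fun u hu => ?_
  rw [Function.update_of_ne (Finset.ne_of_mem_erase hu)]

open Classical in
/-- Integrating out the coordinate `v`, on which the first factor does not depend. -/
theorem integral_pi_mul_eq_integral_update (μ : Measure Ω) [IsProbabilityMeasure μ] (v : V)
    {φ ψ : (V → Ω) → ℝ} (hφ : IsBddMeas φ) (hψ : IsBddMeas ψ)
    (hv : ∀ ω z, φ (Function.update ω v z) = φ ω) :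
    ∫ ω, φ ω * ψ ω ∂(Measure.pi fun _ => μ) =
      ∫ ω, φ ω * ∫ z, ψ (Function.update ω v z) ∂μ ∂(Measure.pi fun _ => μ) := by
  have h := measurePreserving_update μ v
  rw [← h.map_eq, integral_map h.measurable.aemeasurable
    (hφ.mul hψ).1.aestronglyMeasurable, h.map_eq,
    integral_prod_symm _ (((hφ.mul hψ).comp h.measurable).integrable _)]
  simp only [hv, integral_const_mul]

open Classical in
/-- Integrating out an independent set `T` of vertices. -/
theorem integral_mul_prod_eq_integral_mul_prod_codegree (μ : Measure Ω) [IsProbabilityMeasure μ]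
    {W : Ω → Ω → ℝ} (hW : IsBddMeas fun p : Ω × Ω => W p.1 p.2) (N : V → Finset V) (T : Finset V)
    (hN : ∀ v ∈ T, Disjoint (N v) T) {φ : (V → Ω) → ℝ} (hφ : IsBddMeas φ)
    (hφT : ∀ v ∈ T, ∀ ω z, φ (Function.update ω v z) = φ ω) :
    ∫ ω, φ ω * ∏ v ∈ T, ∏ u ∈ N v, W (ω v) (ω u) ∂(Measure.pi fun _ => μ) =
      ∫ ω, φ ω * ∏ v ∈ T, codegree μ W (N v) ω ∂(Measure.pi fun _ => μ) := by
  have hE : ∀ v, IsBddMeas fun ω : V → Ω => ∏ u ∈ N v, W (ω v) (ω u) := fun v =>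
    IsBddMeas.prod _ fun u _ => hW.comp (g := fun ω : V → Ω => (ω v, ω u))
      ((measurable_pi_apply v).prodMk (measurable_pi_apply u))
  induction T using Finset.induction_on generalizing φ with
  | empty => simp
  | insert a T ha ih =>
    have hNa : ∀ v ∈ insert a T, a ∉ N v := fun v hv h =>
      Finset.disjoint_left.mp (hN v hv) h (Finset.mem_insert_self a T)
    have hNT : ∀ v ∈ insert a T, ∀ w ∈ T, w ∉ N v := fun v hv w hw h =>
      Finset.disjoint_left.mp (hN v hv) h (Finset.mem_insert_of_mem hw)
    simp only [Finset.prod_insert ha, ← mul_assoc]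
    rw [ih (fun v hv => (hN v (by simp [hv])).mono_right (Finset.subset_insert _ _))
      (hφ.mul (hE a))]
    · calc
        _ = ∫ ω, (φ ω * ∏ v ∈ T, codegree μ W (N v) ω) * ∏ u ∈ N a, W (ω a) (ω u)
              ∂(Measure.pi fun _ => μ) := by
            congr 1; ext ω; ring
        _ = _ := by
            rw [integral_pi_mul_eq_integral_update μ a
              (hφ.mul (IsBddMeas.prod T fun v _ => hW.codegree (N v))) (hE a)]
            · congr 1; ext ω
              simp only [Function.update_self, prod_update_of_notMem (hNa a (by simp))]
              rw [← codegree]; ring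
            · intro ω z
              rw [hφT a (by simp)]
              congr 1
              exact Finset.prod_congr rfl fun v hv =>
                codegree_update_of_notMem μ W (hNa v (by simp [hv])) ω z
    · intro v hv ω z
      have hva : a ≠ v := fun h => ha (h ▸ hv)
      simp only [hφT v (by simp [hv]), Function.update_of_ne hva,
        prod_update_of_notMem (hNT a (by simp) v hv)]

open Classical in
/-- Integrating out the coordinates in `R`, each of which carries a probability density `k`. -/
theorem integral_mul_prod_eq_integral_of_integral_eq_one (μ : Measure Ω) [IsProbabilityMeasure μ]
    {k : Ω → ℝ} (hk : IsBddMeas k) (hk1 : ∫ y, k y ∂μ = 1) (R : Finset V)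
    {φ : (V → Ω) → ℝ} (hφ : IsBddMeas φ)
    (hφR : ∀ v ∈ R, ∀ ω z, φ (Function.update ω v z) = φ ω) :
    ∫ ω, φ ω * ∏ v ∈ R, k (ω v) ∂(Measure.pi fun _ => μ) =
      ∫ ω, φ ω ∂(Measure.pi fun _ => μ) := by
  induction R using Finset.induction_on with
  | empty => simp
  | insert a R ha ih =>
    rw [← ih fun v hv => hφR v (by simp [hv])]
    simp only [Finset.prod_insert ha, mul_comm (k _), ← mul_assoc]
    rw [integral_pi_mul_eq_integral_update μ a
      (hφ.mul (IsBddMeas.prod R fun v _ => hk.comp (measurable_pi_apply v)))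
      (hk.comp (measurable_pi_apply a))]
    · simp [hk1]
    · intro ω z
      rw [hφR a (by simp), prod_update_of_notMem ha]

end Update

/-! ### The entropy lower bound for the density -/

section EntropyInequality

open InformationTheory (klFun klFun_nonneg)

/-- The linear part `1 - F` of `klFun F` has integral zero, so only `F log F` remains. -/
theorem integral_klFun_of_integral_eq_one {α : Type*} [MeasurableSpace α] {μ : Measure α}
    [IsProbabilityMeasure μ] {F : α → ℝ} (hF : IsBddPos F) (h1 : ∫ x, F x ∂μ = 1) :
    ∫ x, klFun (F x) ∂μ = ∫ x, F x * Real.log (F x) ∂μ := by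
  have hi := (hF.isBddMeas.mul hF.log).integrable μ
  simp only [InformationTheory.klFun_apply]
  have hi' : Integrable (fun x => F x * Real.log (F x) + 1) μ := hi.add (integrable_const 1)
  rw [integral_sub hi' (hF.isBddMeas.integrable μ), integral_add hi (integrable_const 1), h1]
  simp

variable {V Ω : Type*} [MeasurableSpace Ω]

/-- The degree function of `W`. -/
noncomputable def wdegree (μ : Measure Ω) (W : Ω → Ω → ℝ) (z : Ω) : ℝ := ∫ y, W z y ∂μ

/-- The density of a star with centre distributed according to the degree of `W`, and leaves
chosen independently with probability proportional to `W`. -/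
noncomputable def starWeight (μ : Measure Ω) (W : Ω → Ω → ℝ) (S : Finset V)
    (p : Ω × (V → Ω)) : ℝ :=
  wdegree μ W p.1 * ∏ u ∈ S, W p.1 (p.2 u) / wdegree μ W p.1

/-- The joint density of the leaves in a star distributed according to `starWeight`. -/
noncomputable def leafDensity (μ : Measure Ω) (W : Ω → Ω → ℝ) (S : Finset V) (ω : V → Ω) : ℝ :=
  ∫ z, starWeight μ W S (z, ω) ∂μ

theorem measurable_fst_eval_snd (u : V) :
    Measurable fun p : Ω × (V → Ω) => (p.1, p.2 u) :=
  measurable_fst.prodMk ((measurable_pi_apply u).comp measurable_snd)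

/-- Unlike the leaf density, the codegree involves no division by the degree, so it survives a limit
in which `W` may vanish. -/
theorem leafDensity_eq_codegree {μ : Measure Ω} {W : Ω → Ω → ℝ}
    (h1 : ∀ᵐ z ∂μ, wdegree μ W z = 1) (S : Finset V)
    (ω : V → Ω) : leafDensity μ W S ω = codegree μ W S ω := by
  refine integral_congr_ae ?_
  filter_upwards [h1] with z hz
  simp [starWeight, hz]

theorem codegree_nonneg {μ : Measure Ω} {W : Ω → Ω → ℝ}
    (h0 : ∀ x y, 0 ≤ W x y) (S : Finset V) (ω : V → Ω) :
    0 ≤ codegree μ W S ω :=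
  integral_nonneg fun _ => Finset.prod_nonneg fun _ _ => h0 _ _

theorem wdegree_nonneg {μ : Measure Ω} {W : Ω → Ω → ℝ}
    (h0 : ∀ x y, 0 ≤ W x y) (z : Ω) : 0 ≤ wdegree μ W z :=
  integral_nonneg fun _ => h0 _ _

variable {μ : Measure Ω} [IsProbabilityMeasure μ] {W : Ω → Ω → ℝ}

theorem IsBddPos.wdegree (hW : IsBddPos fun p : Ω × Ω => W p.1 p.2) :
    IsBddPos (wdegree μ W) := hW.integral_right μ

theorem IsBddPos.starWeight (hW : IsBddPos fun p : Ω × Ω => W p.1 p.2) (S : Finset V) :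
    IsBddPos (starWeight μ W S) :=
  (hW.wdegree.comp measurable_fst).mul <| IsBddPos.prod S fun u _ =>
    (hW.comp (measurable_fst_eval_snd u)).div (hW.wdegree.comp measurable_fst)

theorem IsBddPos.leafDensity (hW : IsBddPos fun p : Ω × Ω => W p.1 p.2) (S : Finset V) :
    IsBddPos (leafDensity μ W S) :=
  IsBddPos.integral_right (F := fun (ω : V → Ω) z => _root_.starWeight μ W S (z, ω))
    ((hW.starWeight S).comp measurable_swap) μ

/-- The star weight carries one factor of the degree and `S.card` divisions by it. Nonemptiness of
`S` keeps the natural subtraction from truncating. -/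
theorem prod_eq_starWeight_mul (hW : IsBddPos fun p : Ω × Ω => W p.1 p.2) {S : Finset V}
    (hS : S.Nonempty) (p : Ω × (V → Ω)) :
    ∏ u ∈ S, W p.1 (p.2 u) = starWeight μ W S p * wdegree μ W p.1 ^ (S.card - 1) := by
  have h := (hW.wdegree (μ := μ)).pos p.1
  rw [starWeight, Finset.prod_div_distrib, Finset.prod_const]
  obtain ⟨k, hk⟩ := Nat.exists_eq_add_of_lt hS.card_pos
  simp only [zero_add] at hk
  rw [hk, Nat.add_sub_cancel]
  field_simp
  ring

variable [Fintype V]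

open Classical in
-- Given the centre `z`, the leaves are independent with density `W z y / wdegree μ W z`, so those
-- outside `S` integrate to `1`.
theorem integral_starWeight_mul (hW : IsBddPos fun p : Ω × Ω => W p.1 p.2) {S B : Finset V}
    (hSB : S ⊆ B) {φ : (V → Ω) → ℝ} (hφ : IsBddMeas φ)
    (hφS : ∀ v ∉ S, ∀ ω z, φ (Function.update ω v z) = φ ω) (z : Ω) :
    ∫ ω, starWeight μ W B (z, ω) * φ ω ∂(Measure.pi fun _ => μ) =
      ∫ ω, starWeight μ W S (z, ω) * φ ω ∂(Measure.pi fun _ => μ) := by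
  have hz := (hW.wdegree (μ := μ)).pos z
  have hk : IsBddMeas fun y => W z y / wdegree μ W z :=
    ((hW.comp (measurable_prodMk_left (x := z))).div (IsBddPos.const hz)).isBddMeas
  have hk1 : ∫ y, W z y / wdegree μ W z ∂μ = 1 := by
    rw [integral_div, ← wdegree, div_self hz.ne']
  rw [← integral_mul_prod_eq_integral_of_integral_eq_one μ hk hk1 (B \ S)
    (((hW.starWeight S).isBddMeas.comp (measurable_prodMk_left (x := z))).mul hφ)]
  · congr 1; ext ω
    simp only [starWeight]
    rw [← Finset.prod_sdiff hSB]
    ring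
  · intro v hv ω y
    have hvS := (Finset.mem_sdiff.mp hv).2
    rw [hφS v hvS]
    simp only [starWeight, prod_update_of_notMem (F := fun y => W z y / wdegree μ W z) hvS]

theorem integral_starWeight (hW : IsBddPos fun p : Ω × Ω => W p.1 p.2) (B : Finset V) (z : Ω) :
    ∫ ω, starWeight μ W B (z, ω) ∂(Measure.pi fun _ => μ) = wdegree μ W z := by
  have := integral_starWeight_mul (μ := μ) hW (Finset.empty_subset B)
    (IsBddMeas.const (α := V → Ω) 1) (fun _ _ _ _ => rfl) z
  simpa [starWeight] using this

theorem integral_starWeight_mul_fst (hW : IsBddPos fun p : Ω × Ω => W p.1 p.2) (B : Finset V)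
    {F : Ω → ℝ} (hF : IsBddMeas F) :
    ∫ p, starWeight μ W B p * F p.1 ∂(μ.prod (Measure.pi fun _ => μ)) =
      ∫ z, wdegree μ W z * F z ∂μ := by
  rw [integral_prod _ (((hW.starWeight B).isBddMeas.mul (hF.comp measurable_fst)).integrable _)]
  simp only [integral_mul_const, integral_starWeight hW]

open Classical in
theorem integral_starWeight_mul_snd (hW : IsBddPos fun p : Ω × Ω => W p.1 p.2) {S B : Finset V}
    (hSB : S ⊆ B) {φ : (V → Ω) → ℝ} (hφ : IsBddMeas φ)
    (hφS : ∀ v ∉ S, ∀ ω z, φ (Function.update ω v z) = φ ω) :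
    ∫ p, starWeight μ W B p * φ p.2 ∂(μ.prod (Measure.pi fun _ => μ)) =
      ∫ ω, leafDensity μ W S ω * φ ω ∂(Measure.pi fun _ => μ) := by
  have hi := fun S : Finset V => ((hW.starWeight (μ := μ) S).isBddMeas.mul
    (hφ.comp measurable_snd)).integrable (μ.prod (Measure.pi fun _ => μ))
  rw [integral_prod _ (hi B)]
  simp only [integral_starWeight_mul hW hSB hφ hφS]
  rw [← integral_prod (fun p => starWeight μ W S p * φ p.2) (hi S), integral_prod_symm _ (hi S)]
  simp only [integral_mul_const, leafDensity]

theorem integral_leafDensity (hW : IsBddPos fun p : Ω × Ω => W p.1 p.2) (S : Finset V) :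
    ∫ ω, leafDensity μ W S ω ∂(Measure.pi fun _ => μ) = ∫ z, wdegree μ W z ∂μ := by
  have h1 := integral_starWeight_mul_snd (μ := μ) hW (Finset.Subset.refl S)
    (IsBddMeas.const (α := V → Ω) 1) (fun _ _ _ _ => rfl)
  have h2 := integral_starWeight_mul_fst (μ := μ) hW S (IsBddMeas.const 1)
  simp only [mul_one] at h1 h2
  rw [← h1, h2]

/-- The expected logarithm of a codegree with respect to a random star. -/
theorem le_integral_starWeight_mul_log_codegree (hW : IsBddPos fun p : Ω × Ω => W p.1 p.2)
    (h1 : ∫ z, wdegree μ W z ∂μ = 1) {S B : Finset V} (hS : S.Nonempty) (hSB : S ⊆ B) :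
    ∫ ω, klFun (leafDensity μ W S ω) ∂(Measure.pi fun _ => μ) +
        (S.card - 1 : ℕ) * ∫ z, klFun (wdegree μ W z) ∂μ ≤
      ∫ p, starWeight μ W B p * Real.log (codegree μ W S p.2)
        ∂(μ.prod (Measure.pi fun _ => μ)) := by
  classical
  have hf := hW.wdegree (μ := μ)
  have hG := hW.leafDensity (μ := μ) S
  have hg := hW.codegree (μ := μ) S
  have hs := hW.starWeight (μ := μ) S
  rw [integral_starWeight_mul_snd hW hSB hg.log
      (fun v hv ω z => by rw [codegree_update_of_notMem μ W hv]),
    integral_klFun_of_integral_eq_one hG (by rw [integral_leafDensity hW, h1]),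
    integral_klFun_of_integral_eq_one hf h1,
    ← integral_starWeight_mul_fst hW S hf.log,
    integral_prod_symm _ ((hs.isBddMeas.mul (hf.log.comp measurable_fst)).integrable _),
    ← integral_const_mul, ← integral_add ((hG.isBddMeas.mul hG.log).integrable _)]
  · refine integral_mono (IsBddMeas.integrable ?_ _) ((hG.isBddMeas.mul hg.log).integrable _) ?_
    · refine (hG.isBddMeas.mul hG.log).add ((IsBddMeas.const _).mul ?_)
      exact IsBddMeas.integral_right
        (F := fun (ω : V → Ω) z => starWeight μ W S (z, ω) * Real.log (wdegree μ W z))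
        ((hs.isBddMeas.mul (hf.log.comp measurable_fst)).comp measurable_swap) μ
    · intro ω
      -- Jensen over the centre, for fixed leaves `ω`: the star weight times the power of the degree
      -- integrates to the codegree.
      have h := (hs.comp (measurable_prodMk_right (y := ω))).integral_mul_log_le
        (hf.pow (S.card - 1)) μ
      simp only [← prod_eq_starWeight_mul hW hS (_, ω), Real.log_pow] at h
      rw [← codegree, ← leafDensity, Real.log_div (hg.pos ω).ne' (hG.pos ω).ne'] at h
      simp only [mul_left_comm (starWeight μ W S _), integral_const_mul] at h
      simp only
      linarith
  · refine IsBddMeas.integrable ((IsBddMeas.const _).mul ?_) _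
    exact IsBddMeas.integral_right
      (F := fun (ω : V → Ω) z => starWeight μ W S (z, ω) * Real.log (wdegree μ W z))
      ((hs.isBddMeas.mul (hf.log.comp measurable_fst)).comp measurable_swap) μ

theorem integral_klFun_nonneg {α : Type*} [MeasurableSpace α] (ν : Measure α) {F : α → ℝ}
    (hF : ∀ x, 0 ≤ F x) : 0 ≤ ∫ x, klFun (F x) ∂ν :=
  integral_nonneg fun x => klFun_nonneg (hF x)

open Classical in
/-- A stability version of Sidorenko's inequality for bipartite graphs with a vertex complete to
the other side. -/
theorem klFun_add_klFun_le_log_integral (hW : IsBddPos fun p : Ω × Ω => W p.1 p.2)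
    (h1 : ∫ z, wdegree μ W z ∂μ = 1) {B : Finset V} (hB : 2 ≤ B.card) (T : Finset V)
    {N : V → Finset V} (hN : ∀ v ∈ T, N v ⊆ B) {v₀ : V} (hv₀ : v₀ ∈ T) (hv₀N : (N v₀).Nonempty) :
    ∫ z, klFun (wdegree μ W z) ∂μ +
        ∫ ω, klFun (leafDensity μ W (N v₀) ω) ∂(Measure.pi fun _ => μ) ≤
      Real.log (∫ ω, codegree μ W B ω * ∏ v ∈ T, codegree μ W (N v) ω
        ∂(Measure.pi fun _ => μ)) := by
  have hf := hW.wdegree (μ := μ)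
  have hs := hW.starWeight (μ := μ) B
  have hg := fun v => hW.codegree (μ := μ) (N v)
  have hB0 : B.Nonempty := Finset.card_pos.mp (by omega)
  have hlog : ∀ v, IsBddMeas fun p : Ω × (V → Ω) =>
      starWeight μ W B p * Real.log (codegree μ W (N v) p.2) := fun v =>
    hs.isBddMeas.mul ((hg v).log.comp measurable_snd)
  -- Jensen under the random star on `B`; the power of the degree turns the star weight back into
  -- the product of the `W` factors at `x`.
  have hJ := hs.integral_mul_log_le (F := fun p : Ω × (V → Ω) =>
      wdegree μ W p.1 ^ (B.card - 1) * ∏ v ∈ T, codegree μ W (N v) p.2)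
    (((hf.comp measurable_fst).pow _).mul
      (IsBddPos.prod T fun v _ => (hg v).comp measurable_snd)) (μ.prod (Measure.pi fun _ => μ))
  have hs1 : ∫ p, starWeight μ W B p ∂(μ.prod (Measure.pi fun _ => μ)) = 1 := by
    simpa [h1] using integral_starWeight_mul_fst (μ := μ) hW B (IsBddMeas.const 1)
  have hF0 := integral_klFun_nonneg μ fun z => (hf.pos z).le
  have hterm : ∀ v ∈ T, 0 ≤ ∫ p, starWeight μ W B p * Real.log (codegree μ W (N v) p.2)
      ∂(μ.prod (Measure.pi fun _ => μ)) := by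
    intro v hv
    -- A vertex without neighbours has codegree `1`, whose logarithm vanishes.
    rcases (N v).eq_empty_or_nonempty with h | h
    · simp [h, codegree]
    · refine le_trans ?_ (le_integral_starWeight_mul_log_codegree hW h1 h (hN v hv))
      exact add_nonneg (integral_klFun_nonneg _ fun ω => ((hW.leafDensity (N v)).pos ω).le)
        (by positivity)
  have hterm₀ : ∫ ω, klFun (leafDensity μ W (N v₀) ω) ∂(Measure.pi fun _ => μ) ≤
      ∫ p, starWeight μ W B p * Real.log (codegree μ W (N v₀) p.2)
        ∂(μ.prod (Measure.pi fun _ => μ)) := by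
    refine le_trans ?_ (le_integral_starWeight_mul_log_codegree hW h1 hv₀N (hN v₀ hv₀))
    exact le_add_of_nonneg_right (by positivity)
  have hR : ∫ p : Ω × (V → Ω), starWeight μ W B p * (wdegree μ W p.1 ^ (B.card - 1) *
      ∏ v ∈ T, codegree μ W (N v) p.2) ∂(μ.prod (Measure.pi fun _ => μ)) =
      ∫ ω, codegree μ W B ω * ∏ v ∈ T, codegree μ W (N v) ω ∂(Measure.pi fun _ => μ) := by
    rw [integral_prod_symm _ (IsBddMeas.integrable (hs.isBddMeas.mul
      ((((hf.comp measurable_fst).pow _).mul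
      (IsBddPos.prod T fun v _ => (hg v).comp measurable_snd)).isBddMeas)) _)]
    congr 1; ext ω
    simp only [← mul_assoc, ← prod_eq_starWeight_mul hW hB0 (_, ω)]
    rw [integral_mul_const, ← codegree]
  have hL : ∫ p : Ω × (V → Ω), starWeight μ W B p * Real.log (wdegree μ W p.1 ^ (B.card - 1) *
      ∏ v ∈ T, codegree μ W (N v) p.2) ∂(μ.prod (Measure.pi fun _ => μ)) =
      (B.card - 1 : ℕ) * ∫ z, klFun (wdegree μ W z) ∂μ +
      ∑ v ∈ T, ∫ p, starWeight μ W B p * Real.log (codegree μ W (N v) p.2)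
        ∂(μ.prod (Measure.pi fun _ => μ)) := by
    rw [integral_klFun_of_integral_eq_one hf h1, ← integral_starWeight_mul_fst hW B hf.log,
      ← integral_const_mul, ← integral_finsetSum T fun v _ => (hlog v).integrable _,
      ← integral_add (((IsBddMeas.const _).mul
        (hs.isBddMeas.mul (hf.log.comp measurable_fst))).integrable _)
        ((IsBddMeas.sum T fun v _ => hlog v).integrable _)]
    congr 1; ext p
    rw [Real.log_mul (pow_pos (hf.pos _) _).ne' (Finset.prod_pos fun v _ => (hg v).pos _).ne',
      Real.log_pow, Real.log_prod fun v _ => ((hg v).pos _).ne', mul_add, Finset.mul_sum]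
    ring
  rw [hL, hR, hs1, one_mul, div_one] at hJ
  refine le_trans (add_le_add ?_ ?_) hJ
  -- As `B` has at least two elements, the degree entropy occurs with coefficient at least `1`.
  · refine le_mul_of_one_le_left hF0 ?_
    exact_mod_cast (by omega : 1 ≤ B.card - 1)
  · exact hterm₀.trans (Finset.single_le_sum hterm hv₀)

end EntropyInequality

/-! ### Uniformly bounded pointwise convergence -/

section BoundedConvergence

open Filter Topology

variable {α β : Type*} [MeasurableSpace α] [MeasurableSpace β]

/-- The measurable functions `F n` are uniformly bounded and converge pointwise to `F'`. -/
def BddTendsto (F : ℕ → α → ℝ) (F' : α → ℝ) : Prop :=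
  (∀ n, Measurable (F n)) ∧ (∃ C : ℝ, ∀ n x, |F n x| ≤ C) ∧
    ∀ x, Tendsto (fun n => F n x) atTop (𝓝 (F' x))

namespace BddTendsto

theorem tendsto_integral {F : ℕ → α → ℝ} {F' : α → ℝ} (h : BddTendsto F F') (μ : Measure α)
    [IsFiniteMeasure μ] : Tendsto (fun n => ∫ x, F n x ∂μ) atTop (𝓝 (∫ x, F' x ∂μ)) := by
  obtain ⟨hm, ⟨C, hC⟩, hl⟩ := h
  exact tendsto_integral_of_dominated_convergence (fun _ => C)
    (fun n => (hm n).aestronglyMeasurable) (integrable_const C)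
    (fun n => Eventually.of_forall fun x => hC n x) (Eventually.of_forall hl)

theorem mul {F G : ℕ → α → ℝ} {F' G' : α → ℝ} (h : BddTendsto F F') (k : BddTendsto G G') :
    BddTendsto (fun n x => F n x * G n x) (fun x => F' x * G' x) := by
  obtain ⟨hm, ⟨C, hC⟩, hl⟩ := h
  obtain ⟨km, ⟨D, hD⟩, kl⟩ := k
  refine ⟨fun n => (hm n).mul (km n), ⟨C * D, fun n x => ?_⟩, fun x => (hl x).mul (kl x)⟩
  rw [abs_mul]
  exact mul_le_mul (hC n x) (hD n x) (abs_nonneg _) ((abs_nonneg _).trans (hC n x))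

theorem prod {ι : Type*} (s : Finset ι) {F : ι → ℕ → α → ℝ} {F' : ι → α → ℝ}
    (h : ∀ i, BddTendsto (F i) (F' i)) :
    BddTendsto (fun n x => ∏ i ∈ s, F i n x) (fun x => ∏ i ∈ s, F' i x) := by
  classical
  induction s using Finset.induction_on with
  | empty => exact ⟨by simp, ⟨1, by simp⟩, by simp⟩
  | insert i s hi ih =>
    simp only [Finset.prod_insert hi]
    exact (h i).mul ih

theorem comp {F : ℕ → β → ℝ} {F' : β → ℝ} (h : BddTendsto F F') {g : α → β}
    (hg : Measurable g) : BddTendsto (fun n x => F n (g x)) (fun x => F' (g x)) := by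
  obtain ⟨hm, ⟨C, hC⟩, hl⟩ := h
  exact ⟨fun n => (hm n).comp hg, ⟨C, fun n x => hC n _⟩, fun x => hl _⟩

theorem integral_right {F : ℕ → α → β → ℝ} {F' : α → β → ℝ}
    (h : BddTendsto (fun n (p : α × β) => F n p.1 p.2) fun p => F' p.1 p.2)
    (μ : Measure β) [IsProbabilityMeasure μ] :
    BddTendsto (fun n x => ∫ y, F n x y ∂μ) (fun x => ∫ y, F' x y ∂μ) := by
  refine ⟨fun n => ?_, ?_, fun x => ?_⟩
  · exact ((h.1 n).stronglyMeasurable.integral_prod_right').measurable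
  · obtain ⟨C, hC⟩ := h.2.1
    refine ⟨C, fun n x => ?_⟩
    simpa using norm_integral_le_of_norm_le_const (μ := μ) (f := fun y => F n x y) (C := C)
      (Eventually.of_forall fun y => hC n (x, y))
  · exact (h.comp (measurable_prodMk_left (x := x))).tendsto_integral μ

theorem continuous_comp {F : ℕ → α → ℝ} {F' : α → ℝ} (h : BddTendsto F F') {g : ℝ → ℝ}
    (hg : Continuous g) : BddTendsto (fun n x => g (F n x)) (fun x => g (F' x)) := by
  obtain ⟨hm, ⟨C, hC⟩, hl⟩ := h
  obtain ⟨D, hD⟩ := (isCompact_Icc (a := -C) (b := C)).exists_bound_of_continuousOn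
    hg.continuousOn
  exact ⟨fun n => hg.measurable.comp (hm n), ⟨D, fun n x => hD _ (abs_le.mp (hC n x))⟩,
    fun x => (hg.tendsto _).comp (hl x)⟩

theorem codegree {V Ω : Type*} [MeasurableSpace Ω] {μ : Measure Ω} [IsProbabilityMeasure μ]
    {W : ℕ → Ω → Ω → ℝ} {W' : Ω → Ω → ℝ}
    (h : BddTendsto (fun n (p : Ω × Ω) => W n p.1 p.2) fun p => W' p.1 p.2) (S : Finset V) :
    BddTendsto (fun n => codegree μ (W n) S) (codegree μ W' S) := by
  refine BddTendsto.integral_right (F := fun n (ω : V → Ω) z => ∏ u ∈ S, W n z (ω u))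
    (F' := fun (ω : V → Ω) z => ∏ u ∈ S, W' z (ω u)) ?_ μ
  exact BddTendsto.prod S fun u => h.comp (g := fun p : (V → Ω) × Ω => (p.2, p.1 u))
    (measurable_snd.prodMk ((measurable_pi_apply u).comp measurable_fst))

end BddTendsto

end BoundedConvergence

/-! ### The equality case, by perturbation -/

section Equality

open Filter Topology
open InformationTheory (klFun klFun_nonneg)

variable {V Ω : Type*} [Fintype V] [MeasurableSpace Ω] {μ : Measure Ω} [IsProbabilityMeasure μ]
  {W : Ω → Ω → ℝ}

/-- A small perturbation of `W` that is bounded away from `0`. -/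
noncomputable def perturb (W : Ω → Ω → ℝ) (n : ℕ) (x y : Ω) : ℝ :=
  (W x y + 1 / ((n : ℝ) + 1)) / (1 + 1 / ((n : ℝ) + 1))

theorem perturb_nonneg_le {C w : ℝ} (hw : 0 ≤ w) (hC : w ≤ C) (n : ℕ) :
    (1 / ((n : ℝ) + 1)) / (1 + 1 / ((n : ℝ) + 1)) ≤
        (w + 1 / ((n : ℝ) + 1)) / (1 + 1 / ((n : ℝ) + 1)) ∧
      (w + 1 / ((n : ℝ) + 1)) / (1 + 1 / ((n : ℝ) + 1)) ≤ C + 1 := by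
  have he : 0 < 1 / ((n : ℝ) + 1) := by positivity
  have he1 : 1 / ((n : ℝ) + 1) ≤ 1 := by
    rw [div_le_one (by positivity)]
    linarith [n.cast_nonneg (α := ℝ)]
  set e := 1 / ((n : ℝ) + 1)
  constructor
  · gcongr; linarith
  · rw [div_le_iff₀ (by positivity)]
    nlinarith

theorem isBddPos_perturb (hW : IsBddMeas fun p : Ω × Ω => W p.1 p.2)
    (h0 : ∀ x y, 0 ≤ W x y) (n : ℕ) : IsBddPos fun p : Ω × Ω => perturb W n p.1 p.2 := by
  obtain ⟨hm, C, hC⟩ := hW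
  refine ⟨(hm.add_const _).div_const _, (1 / ((n : ℝ) + 1)) / (1 + 1 / ((n : ℝ) + 1)),
    by positivity, C + 1, fun p => perturb_nonneg_le (h0 _ _) ((le_abs_self _).trans (hC p)) n⟩

theorem bddTendsto_perturb (hW : IsBddMeas fun p : Ω × Ω => W p.1 p.2)
    (h0 : ∀ x y, 0 ≤ W x y) :
    BddTendsto (fun n (p : Ω × Ω) => perturb W n p.1 p.2) fun p => W p.1 p.2 := by
  refine ⟨fun n => (isBddPos_perturb hW h0 n).1, ?_, fun p => ?_⟩
  · have hpos := fun n => (isBddPos_perturb hW h0 n).pos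
    obtain ⟨hm, C, hC⟩ := hW
    refine ⟨C + 1, fun n p => ?_⟩
    rw [abs_of_pos (hpos n p)]
    exact (perturb_nonneg_le (h0 _ _) ((le_abs_self _).trans (hC p)) n).2
  · have h := tendsto_one_div_add_atTop_nhds_zero_nat (𝕜 := ℝ)
    simpa [perturb, Pi.div_def] using
      (h.const_add (W p.1 p.2)).div (h.const_add (1 : ℝ)) (by norm_num)

theorem wdegree_perturb (hW : IsBddMeas fun p : Ω × Ω => W p.1 p.2) (n : ℕ) (z : Ω) :
    wdegree μ (perturb W n) z =
      (wdegree μ W z + 1 / ((n : ℝ) + 1)) / (1 + 1 / ((n : ℝ) + 1)) := by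
  simp only [wdegree, perturb]
  rw [integral_div, integral_add ((hW.comp (measurable_prodMk_left (x := z))).integrable μ)
    (integrable_const _)]
  simp

/-- The denominator in `perturb` is chosen to keep the total density equal to `1`. -/
theorem integral_wdegree_perturb (hW : IsBddMeas fun p : Ω × Ω => W p.1 p.2)
    (h1 : ∫ z, wdegree μ W z ∂μ = 1) (n : ℕ) : ∫ z, wdegree μ (perturb W n) z ∂μ = 1 := by
  simp only [wdegree_perturb hW]
  rw [integral_div, integral_add (f := wdegree μ W) ((hW.integral_right μ).integrable μ)
    (integrable_const _), h1]
  simp only [integral_const, probReal_univ, one_smul]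
  have : (0 : ℝ) < 1 + 1 / ((n : ℝ) + 1) := by positivity
  exact div_self this.ne'

theorem ae_eq_one_of_integral_klFun_le {α : Type*} [MeasurableSpace α] {ν : Measure α}
    [IsProbabilityMeasure ν] {F : α → ℝ} (hF : IsBddMeas F) (h0 : ∀ x, 0 ≤ F x)
    (h : ∫ x, klFun (F x) ∂ν ≤ 0) : ∀ᵐ x ∂ν, F x = 1 := by
  have h' := le_antisymm h (integral_klFun_nonneg ν h0)
  rw [integral_eq_zero_iff_of_nonneg (fun x => klFun_nonneg (h0 x)) (hF.klFun.integrable ν)] at h'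
  filter_upwards [h'] with x hx
  exact (InformationTheory.klFun_eq_zero_iff (h0 x)).mp hx

/-- The equality case of Sidorenko's inequality: degrees and codegrees are constant. -/
theorem ae_wdegree_eq_one_and_codegree_eq_one (hW : IsBddMeas fun p : Ω × Ω => W p.1 p.2)
    (h0 : ∀ x y, 0 ≤ W x y) (h1 : ∫ z, wdegree μ W z ∂μ = 1) {B : Finset V} (hB : 2 ≤ B.card)
    (T : Finset V) {N : V → Finset V} (hN : ∀ v ∈ T, N v ⊆ B) {v₀ : V} (hv₀ : v₀ ∈ T)
    (hv₀N : (N v₀).Nonempty)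
    (ht : ∫ ω, codegree μ W B ω * ∏ v ∈ T, codegree μ W (N v) ω ∂(Measure.pi fun _ => μ) = 1) :
    (∀ᵐ z ∂μ, wdegree μ W z = 1) ∧
      ∀ᵐ ω ∂(Measure.pi fun _ => μ), codegree μ W (N v₀) ω = 1 := by
  have hP := isBddPos_perturb hW h0
  have hlim := bddTendsto_perturb hW h0
  have hmain := fun n => klFun_add_klFun_le_log_integral (hP n)
    (integral_wdegree_perturb hW h1 n) hB T hN hv₀ hv₀N
  have hlog : Tendsto (fun n => Real.log (∫ ω, codegree μ (perturb W n) B ω *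
      ∏ v ∈ T, codegree μ (perturb W n) (N v) ω ∂(Measure.pi fun _ => μ))) atTop (𝓝 0) := by
    rw [← Real.log_one]
    refine (Real.continuousAt_log one_ne_zero).tendsto.comp ?_
    rw [← ht]
    exact ((hlim.codegree B).mul (BddTendsto.prod T fun v =>
      hlim.codegree (N v))).tendsto_integral _
  have hdeg : ∀ᵐ z ∂μ, wdegree μ W z = 1 := by
    refine ae_eq_one_of_integral_klFun_le (hW.integral_right μ) (wdegree_nonneg h0) ?_
    refine le_of_tendsto_of_tendsto' (((hlim.integral_right μ).continuous_comp
      InformationTheory.continuous_klFun).tendsto_integral μ) hlog fun n => ?_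
    refine le_trans (le_add_of_nonneg_right ?_) (hmain n)
    exact integral_klFun_nonneg _ fun ω => (((hP n).leafDensity (N v₀)).pos ω).le
  refine ⟨hdeg, ae_eq_one_of_integral_klFun_le (hW.codegree _) (codegree_nonneg h0 _) ?_⟩
  refine le_of_tendsto_of_tendsto' (((hlim.codegree (N v₀)).continuous_comp
    InformationTheory.continuous_klFun).tendsto_integral _) hlog fun n => ?_
  -- Perturbing preserves degree `1`, so the leaf density in the entropy bound may be replaced by
  -- the codegree before taking the limit.
  have hdeg' : ∀ᵐ z ∂μ, wdegree μ (perturb W n) z = 1 := by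
    filter_upwards [hdeg] with z hz
    have : (0 : ℝ) < 1 + 1 / ((n : ℝ) + 1) := by positivity
    rw [wdegree_perturb hW, hz, div_self this.ne']
  have h := hmain n
  simp only [leafDensity_eq_codegree hdeg'] at h
  refine le_trans (le_add_of_nonneg_left ?_) h
  exact integral_klFun_nonneg _ fun z => ((hP n).wdegree.pos z).le

end Equality

/-! ### From constant degrees and codegrees to a constant kernel -/

section Constancy

variable {V Ω : Type*} [Fintype V] [MeasurableSpace Ω] {μ : Measure Ω} [IsProbabilityMeasure μ]
  {W : Ω → Ω → ℝ}

open Classical in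
theorem integral_prod_mul_prod_of_integral_eq_one {a φ : Ω → ℝ} (ha : ∫ y, a y ∂μ = 1)
    {S D : Finset V} (hD : D ⊆ S) :
    ∫ ω, (∏ v ∈ S, a (ω v)) * ∏ v ∈ D, φ (ω v) ∂(Measure.pi fun _ => μ) =
      (∫ y, a y * φ y ∂μ) ^ D.card := by
  have h := integral_fintype_prod_eq_prod (μ := fun _ : V => μ)
    (fun v y => (if v ∈ S then a y else 1) * if v ∈ D then φ y else 1)
  simp only [Finset.prod_mul_distrib, Finset.prod_ite_mem, Finset.univ_inter] at h
  rw [h, ← Finset.prod_const, ← Finset.prod_subset (Finset.subset_univ D)]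
  · exact Finset.prod_congr rfl fun v hv => by simp [hv, hD hv]
  · intro v _ hv
    by_cases hS : v ∈ S <;> simp [hv, hS, ha]

/-- A variance argument: two coordinates of `S` give the second moment of `z ↦ ∫ y in t, W z y`, the
degree condition and symmetry give its mean, and the variance is zero. -/
theorem ae_setIntegral_eq_of_codegree_eq_one (hW : IsBddMeas fun p : Ω × Ω => W p.1 p.2)
    (hsymm : ∀ x y, W x y = W y x) (hdeg : ∀ᵐ z ∂μ, wdegree μ W z = 1) {S : Finset V}
    (hS : 2 ≤ S.card) (hcod : ∀ᵐ ω ∂(Measure.pi fun _ => μ), codegree μ W S ω = 1)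
    {t : Set Ω} (ht : MeasurableSet t) :
    ∀ᵐ z ∂μ, ∫ y in t, W z y ∂μ = μ.real t := by
  classical
  obtain ⟨D, hDS, hD⟩ := Finset.exists_subset_card_eq hS
  set φ : Ω → ℝ := t.indicator fun _ => 1 with hφdef
  have hφ : IsBddMeas φ := by
    refine ⟨measurable_const.indicator ht, 1, fun x => ?_⟩
    by_cases hx : x ∈ t <;> simp [hφdef, hx]
  have hφm : ∫ y, φ y ∂μ = μ.real t := integral_indicator_one ht
  have hφW : ∀ z, ∫ y, W z y * φ y ∂μ = ∫ y in t, W z y ∂μ := by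
    intro z
    rw [← integral_indicator ht]
    congr 1; ext y
    by_cases hy : y ∈ t <;> simp [hφdef, hy]
  have hWφ : IsBddMeas fun p : Ω × Ω => W p.1 p.2 * φ p.2 := hW.mul (hφ.comp measurable_snd)
  have hψ : IsBddMeas fun z => ∫ y, W z y * φ y ∂μ := hWφ.integral_right μ
  have hjoint : IsBddMeas fun p : Ω × (V → Ω) =>
      (∏ v ∈ S, W p.1 (p.2 v)) * ∏ v ∈ D, φ (p.2 v) :=
    (IsBddMeas.prod S fun u _ => hW.comp (measurable_fst_eval_snd u)).mul
      (IsBddMeas.prod D fun u _ => hφ.comp ((measurable_pi_apply u).comp measurable_snd))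
  -- Coordinates in `S \ D` contribute the degree `1`; the two in `D` produce the square. Swapping
  -- the integrals brings in the codegree.
  have hsq : ∫ z, (∫ y, W z y * φ y ∂μ) ^ 2 ∂μ = μ.real t ^ 2 := by
    calc
      _ = ∫ z, ∫ ω, (∏ v ∈ S, W z (ω v)) * ∏ v ∈ D, φ (ω v) ∂(Measure.pi fun _ => μ) ∂μ := by
        refine integral_congr_ae ?_
        filter_upwards [hdeg] with z hz
        rw [integral_prod_mul_prod_of_integral_eq_one hz hDS, hD]
      _ = ∫ ω, codegree μ W S ω * ∏ v ∈ D, φ (ω v) ∂(Measure.pi fun _ => μ) := by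
        rw [integral_integral_swap (hjoint.integrable _)]
        simp only [integral_mul_const, codegree]
      _ = ∫ ω, (∏ v ∈ S, (1 : ℝ)) * ∏ v ∈ D, φ (ω v) ∂(Measure.pi fun _ : V => μ) := by
        refine integral_congr_ae ?_
        filter_upwards [hcod] with ω hω
        rw [hω, Finset.prod_const_one]
      _ = _ := by
        rw [integral_prod_mul_prod_of_integral_eq_one (a := fun _ => (1 : ℝ)) (by simp) hDS, hD]
        simp [hφm]
  have hlin : ∫ z, ∫ y, W z y * φ y ∂μ ∂μ = μ.real t := by
    rw [integral_integral_swap (hWφ.integrable _), ← hφm]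
    refine integral_congr_ae ?_
    filter_upwards [hdeg] with y hy
    rw [integral_mul_const]
    simp only [hsymm _ y]
    rw [← wdegree, hy, one_mul]
  have hvar : ∫ z, (∫ y, W z y * φ y ∂μ - μ.real t) ^ 2 ∂μ = 0 := by
    have hi1 : Integrable (fun z => (∫ y, W z y * φ y ∂μ) ^ 2) μ := by
      simpa only [sq] using (hψ.mul hψ).integrable μ
    have hi2 : Integrable (fun z => 2 * μ.real t * ∫ y, W z y * φ y ∂μ) μ :=
      (hψ.integrable μ).const_mul _
    have hi3 : Integrable (fun z => (∫ y, W z y * φ y ∂μ) ^ 2 -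
      2 * μ.real t * ∫ y, W z y * φ y ∂μ) μ := hi1.sub hi2
    calc
      _ = ∫ z, ((∫ y, W z y * φ y ∂μ) ^ 2 - 2 * μ.real t * ∫ y, W z y * φ y ∂μ)
            + μ.real t ^ 2 ∂μ := by
        congr 1; ext z; ring
      _ = 0 := by
        rw [integral_add hi3 (integrable_const _), integral_sub hi1 hi2, integral_const_mul,
          hsq, hlin]
        simp
        ring
  have hsqb : IsBddMeas fun z => (∫ y, W z y * φ y ∂μ - μ.real t) ^ 2 := by
    simpa only [sq, sub_eq_add_neg] using
      (hψ.add (IsBddMeas.const _)).mul (hψ.add (IsBddMeas.const _))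
  rw [integral_eq_zero_iff_of_nonneg (fun z => sq_nonneg _) (hsqb.integrable μ)] at hvar
  filter_upwards [hvar] with z hz
  rw [← hφW]
  exact sub_eq_zero.mp (pow_eq_zero_iff two_ne_zero |>.mp hz)

/-- The measure with density `W` agrees with `μ.prod μ` on measurable rectangles, hence everywhere,
and densities are unique almost everywhere. -/
theorem ae_eq_one_of_ae_setIntegral_eq (hW : IsBddMeas fun p : Ω × Ω => W p.1 p.2)
    (h0 : ∀ x y, 0 ≤ W x y)
    (h : ∀ t, MeasurableSet t → ∀ᵐ z ∂μ, ∫ y in t, W z y ∂μ = μ.real t) :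
    ∀ᵐ p ∂(μ.prod μ), W p.1 p.2 = 1 := by
  have hmeas : Measurable fun p : Ω × Ω => ENNReal.ofReal (W p.1 p.2) := hW.1.ennreal_ofReal
  have hint := hW.integrable (μ.prod μ)
  have key : μ.prod μ = (μ.prod μ).withDensity fun p => ENNReal.ofReal (W p.1 p.2) := by
    refine Measure.prod_eq fun s t hs ht => ?_
    rw [withDensity_apply _ (hs.prod ht), ← ofReal_integral_eq_lintegral_ofReal
      hint.integrableOn (Filter.Eventually.of_forall fun p => h0 _ _),
      setIntegral_prod _ hint.integrableOn,
      integral_congr_ae (ae_restrict_of_ae (h t ht))]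
    simp only [integral_const, smul_eq_mul, measureReal_restrict_apply_univ]
    rw [ENNReal.ofReal_mul measureReal_nonneg, ofReal_measureReal, ofReal_measureReal]
  have h1 : (μ.prod μ).withDensity (fun _ => 1) =
      (μ.prod μ).withDensity fun p => ENNReal.ofReal (W p.1 p.2) := by
    rw [← key]
    exact withDensity_one
  rw [withDensity_eq_iff_of_sigmaFinite aemeasurable_const hmeas.aemeasurable] at h1
  filter_upwards [h1] with p hp
  exact (ENNReal.ofReal_eq_one.mp hp.symm)

theorem measurePreserving_eval_pair {i j : V} (hij : i ≠ j) :
    MeasurePreserving (fun ω : V → Ω => (ω i, ω j)) (Measure.pi fun _ => μ) (μ.prod μ) := by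
  classical
  have hm : Measurable fun ω : V → Ω => (ω i, ω j) :=
    (measurable_pi_apply i).prodMk (measurable_pi_apply j)
  refine ⟨hm, ?_⟩
  -- After coordinate `i` is resampled, it is independent of coordinate `j`, which is unaffected.
  have hu := measurePreserving_update μ i
  have hp := (MeasurePreserving.id μ).prod (measurePreserving_eval (fun _ : V => μ) j)
  rw [← hu.map_eq, Measure.map_map hm hu.measurable, ← hp.map_eq]
  congr 1
  ext p <;> simp [Function.update_of_ne hij.symm, Function.eval]

end Constancy

/-! ### Cycles and edges in bipartite graphs -/

section Graph

variable {V : Type*} {H : SimpleGraph V} {A B : Set V}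

/-- A cycle in a bipartite graph meets each side in at least two vertices. -/
theorem SimpleGraph.IsBipartiteWith.exists_ne_two_le_ncard_neighborSet [Finite V]
    (hAB : H.IsBipartiteWith A B) (hcycle : ¬ H.IsAcyclic) (x : V) :
    ∃ v, v ≠ x ∧ v ∉ B ∧ 2 ≤ (H.neighborSet v).ncard := by
  classical
  have hexists : ∃ (u : V) (c : H.Walk u u), c.IsCycle ∧ u ∈ B := by
    simp only [SimpleGraph.IsAcyclic, not_forall, not_not] at hcycle
    obtain ⟨u, c, hc⟩ := hcycle
    by_cases hu : u ∈ B
    · exact ⟨u, c, hc, hu⟩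
    -- A cycle based outside `B` has its second vertex in `B`; it is rebased there.
    · have hs : c.snd ∈ c.support := c.getVert_mem_support 1
      refine ⟨c.snd, c.rotate c.snd hs, hc.rotate hs, ?_⟩
      rcases hAB.mem_of_adj (c.adj_snd hc.not_nil) with h | h
      · exact h.2
      · exact absurd h.1 hu
  obtain ⟨u, c, hc, hu⟩ := hexists
  have hnotB : ∀ v, H.Adj u v → v ∉ B := by
    intro v hv hvB
    rcases hAB.mem_of_adj hv with h | h
    · exact Set.disjoint_left.mp hAB.disjoint h.1 hu
    · exact Set.disjoint_left.mp hAB.disjoint h.2 hvB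
  have hdeg : ∀ v ∈ c.support, 2 ≤ (H.neighborSet v).ncard := by
    intro v hv
    rw [← hc.ncard_neighborSet_toSubgraph_eq_two hv]
    exact Set.ncard_le_ncard (c.toSubgraph.neighborSet_subset v) (Set.toFinite _)
  -- The two neighbours of `u` along the cycle are distinct, so at least one of them is not `x`.
  by_cases hx : c.snd = x
  · exact ⟨c.penultimate, fun h => hc.snd_ne_penultimate (hx.trans h.symm),
      hnotB _ (c.adj_penultimate hc.not_nil).symm, hdeg _ (c.getVert_mem_support _)⟩
  · exact ⟨c.snd, hx, hnotB _ (c.adj_snd hc.not_nil), hdeg _ (c.getVert_mem_support 1)⟩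

open Classical in
-- Each edge has exactly one endpoint outside `B`, which orients it canonically.
theorem SimpleGraph.IsBipartiteWith.prod_edgeFinset_eq [Fintype V] [Fintype H.edgeSet]
    (hAB : H.IsBipartiteWith A B) (g : Sym2 V → ℝ) :
    ∏ e ∈ H.edgeFinset, g e =
      ∏ v with v ∉ B, ∏ u with H.Adj v u, g s(v, u) := by
  rw [Finset.prod_sigma']
  symm
  refine Finset.prod_bij (fun p _ => s(p.1, p.2)) ?_ ?_ ?_ ?_
  · rintro ⟨v, u⟩ h
    simp only [Finset.mem_sigma, Finset.mem_filter, Finset.mem_univ, true_and] at h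
    simpa using h.2
  · rintro ⟨v, u⟩ h ⟨v', u'⟩ h' heq
    simp only [Finset.mem_sigma, Finset.mem_filter, Finset.mem_univ, true_and] at h h'
    rcases Sym2.eq_iff.mp heq with ⟨rfl, rfl⟩ | ⟨rfl, rfl⟩
    · rfl
    · rcases hAB.mem_of_adj h.2 with hm | hm
      · exact absurd hm.2 h'.1
      · exact absurd hm.1 h.1
  · intro e
    induction e with
    | _ a b =>
      intro he
      have hab : H.Adj a b := by simpa using he
      rcases hAB.mem_of_adj hab with hm | hm
      · exact ⟨⟨a, b⟩, by simpa [hab] using Set.disjoint_left.mp hAB.disjoint hm.1, rfl⟩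
      · exact ⟨⟨b, a⟩, by simpa [hab.symm] using Set.disjoint_left.mp hAB.disjoint hm.2,
          Sym2.eq_swap⟩
  · intro _ _; rfl

end Graph

/-! ### Densities as codegree integrals, and the forcing theorem -/

section Main

variable {V Ω : Type*} [Fintype V] [MeasurableSpace Ω] {μ : Measure Ω}
  {W : Ω → Ω → ℝ} {H : SimpleGraph V} [Fintype H.edgeSet]

open Classical in
theorem homDensity_eq_integral_prod_codegree [IsProbabilityMeasure μ] {A B : Set V}
    (hAB : H.IsBipartiteWith A B) (hsymm : ∀ x y, W x y = W y x)
    (hW : IsBddMeas fun p : Ω × Ω => W p.1 p.2) :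
    homDensity H μ W hsymm = ∫ ω, ∏ v with v ∉ B, codegree μ W {u | H.Adj v u} ω
      ∂(Measure.pi fun _ => μ) := by
  have h := integral_mul_prod_eq_integral_mul_prod_codegree μ hW
    (fun v => ({u | H.Adj v u} : Finset V)) {v | v ∉ B} ?_ (IsBddMeas.const 1)
    (fun _ _ _ _ => rfl)
  · simp only [one_mul] at h
    rw [← h, homDensity]
    congr 1; ext ω
    rw [hAB.prod_edgeFinset_eq fun e => Sym2.lift ⟨W, hsymm⟩ (e.map ω)]
    rfl
  · intro v hv
    rw [Finset.disjoint_left]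
    intro u hu hu'
    simp only [Finset.mem_filter, Finset.mem_univ, true_and] at hv hu hu'
    rcases hAB.mem_of_adj hu with hm | hm
    · exact hu' hm.2
    · exact hv hm.1

theorem homDensity_div (hsymm : ∀ x y, W x y = W y x) (d : ℝ) :
    homDensity H μ (fun x y => W x y / d) (fun x y => by rw [hsymm]) =
      homDensity H μ W hsymm / d ^ H.edgeFinset.card := by
  rw [homDensity, homDensity, ← integral_div]
  congr 1; ext ω
  rw [← Finset.prod_const, ← Finset.prod_div_distrib]
  refine Finset.prod_congr rfl fun e _ => ?_
  induction e with
  | _ a b => rfl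

theorem homDensity_of_ae_eq_const [IsProbabilityMeasure μ] (hsymm : ∀ x y, W x y = W y x) {c : ℝ}
    (hc : ∀ᵐ p ∂(μ.prod μ), W p.1 p.2 = c) :
    homDensity H μ W hsymm = c ^ H.edgeFinset.card := by
  have h : ∀ᵐ ω ∂(Measure.pi fun _ : V => μ), ∀ e ∈ H.edgeFinset,
      Sym2.lift ⟨W, hsymm⟩ (e.map ω) = c := by
    rw [Finset.eventually_all]
    intro e
    induction e with
    | _ a b =>
      intro he
      have hab : H.Adj a b := by simpa using he
      exact (measurePreserving_eval_pair hab.ne).quasiMeasurePreserving.ae hc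
  rw [homDensity, integral_congr_ae (g := fun _ => c ^ H.edgeFinset.card)]
  · simp
  · filter_upwards [h] with ω hω
    rw [Finset.prod_congr rfl hω, Finset.prod_const]

theorem ae_eq_one_of_homDensity_eq_one [IsProbabilityMeasure μ] {A B : Set V}
    (hAB : H.IsBipartiteWith A B) {x : V} (hxA : x ∈ A) (hxB : ∀ v ∈ B, H.Adj x v)
    (hcycle : ¬ H.IsAcyclic) (hsymm : ∀ x y, W x y = W y x)
    (hW : IsBddMeas fun p : Ω × Ω => W p.1 p.2) (h0 : ∀ x y, 0 ≤ W x y)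
    (hd : edgeDensity μ W = 1) (ht : homDensity H μ W hsymm = 1) :
    ∀ᵐ p ∂(μ.prod μ), W p.1 p.2 = 1 := by
  classical
  have h1 : ∫ z, wdegree μ W z ∂μ = 1 := by
    rw [← hd, edgeDensity, integral_prod _ (hW.integrable _)]
    rfl
  obtain ⟨v₀, hv₀x, hv₀B, hv₀⟩ := hAB.exists_ne_two_le_ncard_neighborSet hcycle x
  have hxnB : x ∉ B := Set.disjoint_left.mp hAB.disjoint hxA
  set N : V → Finset V := fun v => {u | H.Adj v u} with hNdef
  -- Here `x` being complete to `B` is used: `N x` takes the role of the full leaf set in the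
  -- entropy bound.
  have hN : ∀ v ∈ ({v | v ∉ B} : Finset V), N v ⊆ N x := by
    intro v hv u hu
    simp only [hNdef, Finset.mem_filter, Finset.mem_univ, true_and] at hv hu ⊢
    rcases hAB.mem_of_adj hu with hm | hm
    · exact hxB u hm.2
    · exact absurd hm.1 hv
  have hcard : 2 ≤ (N v₀).card := by
    rw [← Set.ncard_coe_finset]
    convert hv₀
    ext u; simp [hNdef]
  have hxT : x ∈ ({v | v ∉ B} : Finset V) := by simpa using hxnB
  have hv₀T : v₀ ∈ ({v | v ∉ B} : Finset V) := by simpa using hv₀B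
  rw [homDensity_eq_integral_prod_codegree hAB hsymm hW] at ht
  simp only [← Finset.mul_prod_erase _ _ hxT] at ht
  obtain ⟨hdeg, hcod⟩ := ae_wdegree_eq_one_and_codegree_eq_one (N := N) hW h0 h1
    (hcard.trans (Finset.card_le_card (hN v₀ hv₀T))) (Finset.erase {v | v ∉ B} x)
    (fun v hv => hN v (Finset.mem_of_mem_erase hv)) (Finset.mem_erase.mpr ⟨hv₀x, hv₀T⟩)
    (Finset.card_pos.mp (by omega)) ht
  exact ae_eq_one_of_ae_setIntegral_eq hW h0 fun t hT =>
    ae_setIntegral_eq_of_codegree_eq_one hW hsymm hdeg hcard hcod hT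

end Main

theorem mainTheorem5 {V : Type*} [Fintype V] (H : SimpleGraph V) [Fintype H.edgeSet]
    (A B : Set V) (hAB : H.IsBipartiteWith A B)
    (x : V) (hxA : x ∈ A) (hxB : ∀ v ∈ B, H.Adj x v)
    (hcycle : ¬ H.IsAcyclic)
    {Ω : Type*} [MeasurableSpace Ω] (μ : Measure Ω) [IsProbabilityMeasure μ]
    (W : Ω → Ω → ℝ) (hsymm : ∀ x y, W x y = W y x)
    (hmeas : Measurable fun p : Ω × Ω => W p.1 p.2)
    (hnonneg : ∀ x y, 0 ≤ W x y) (hbdd : ∃ C : ℝ, ∀ x y, W x y ≤ C) :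
    homDensity H μ W hsymm = edgeDensity μ W ^ H.edgeFinset.card ↔
      ∃ c : ℝ, ∀ᵐ p ∂(μ.prod μ), W p.1 p.2 = c := by
  obtain ⟨C, hC⟩ := hbdd
  have hW : IsBddMeas fun p : Ω × Ω => W p.1 p.2 :=
    ⟨hmeas, C, fun p => by rw [abs_of_nonneg (hnonneg _ _)]; exact hC _ _⟩
  constructor
  · intro ht
    have hd0 : 0 ≤ edgeDensity μ W := integral_nonneg fun p => hnonneg _ _
    -- Zero density cannot be normalised, but then the nonnegative `W` vanishes almost everywhere.
    rcases hd0.eq_or_lt with hd | hd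
    · refine ⟨0, ?_⟩
      have h := hd.symm
      rwa [edgeDensity, integral_eq_zero_iff_of_nonneg (fun p => hnonneg _ _)
        (hW.integrable _)] at h
    · refine ⟨edgeDensity μ W, ?_⟩
      have h := ae_eq_one_of_homDensity_eq_one (μ := μ)
        (W := fun x y => W x y / edgeDensity μ W) hAB hxA hxB hcycle
        (fun x y => by rw [hsymm])
        (by simpa only [div_eq_mul_inv] using hW.mul (IsBddMeas.const (edgeDensity μ W)⁻¹))
        (fun x y => div_nonneg (hnonneg x y) hd0)
        (by rw [edgeDensity, integral_div, ← edgeDensity, div_self hd.ne'])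
        (by rw [homDensity_div hsymm, ht, div_self (pow_pos hd _).ne'])
      filter_upwards [h] with p hp
      exact (div_eq_one_iff_eq hd.ne').mp hp
  · rintro ⟨c, hc⟩
    have hd : edgeDensity μ W = c := by
      rw [edgeDensity, integral_congr_ae hc]
      simp
    rw [hd, homDensity_of_ae_eq_const hsymm hc]
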